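/- Let $(R,\mathfrak m)$ be a Noetherian local commutative ring of prime characteristic $p>0$, and let $M$ be a finitely generated $R$-module. For $n\ge 0$, let $\varphi^n\colon R\to R$, $r\mapsto r^{p^n}$, be the $n$-th iterate of the Frobenius endomorphism, let ${}^{\varphi^n}\!R$ denote $R$ viewed as an $R$-module via $a\cdot b=a^{p^n}b$, and let $\mathfrak m^{[p^n]}=\varphi^n(\mathfrak m)R$ be the ideal generated by the $p^n$-th powers of the elements of $\mathfrak m$. Let $$\operatorname{drs}_p(R)=\inf\{\,p^e\ge 1 \mid \mathfrak m^{[p^e]}\subseteq(\boldsymbol x)\text{ for some maximal }R\text{-sequence }\boldsymbol x\,\}$$ be the bracket Loewy length of $R$. Suppose that $R$ is Cohen--Macaulay of positive dimension, and let $n\ge 0$ be an integer such that $p^n\ge\operatorname{drs}_p(R)$. If $\operatorname{Tor}_i^R(M,{}^{\varphi^n}\!R)=0$ for $\operatorname{depth}R$ consecutive values of $i>0$, then $M$ has finite projective dimension. -/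

import Mathlib

open CategoryTheory

universe u

namespace FrobeniusTor

/-- The depth of a local ring: the supremum of the lengths of its regular sequences.
(A regular sequence generates a proper ideal, so over a local ring its terms lie in the maximal
ideal.) -/
noncomputable def depth (R : Type u) [CommRing R] [IsLocalRing R] : ℕ∞ :=
  sSup {d : ℕ∞ | ∃ xs : List R, RingTheory.Sequence.IsRegular R xs ∧ d = (xs.length : ℕ∞)}

/-- A (Noetherian) local ring is Cohen-Macaulay if its depth equals its Krull dimension. -/
def IsCohenMacaulayLocal (R : Type u) [CommRing R] [IsLocalRing R] : Prop :=
  ((depth R : ℕ∞) : WithBot ℕ∞) = ringKrullDim R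

/-- A maximal `R`-sequence: a regular sequence that cannot be extended to a longer one. -/
def IsMaximalRegularSequence (R : Type u) [CommRing R] (xs : List R) : Prop :=
  RingTheory.Sequence.IsRegular R xs ∧
    ∀ y : R, ¬ RingTheory.Sequence.IsRegular R (xs ++ [y])

/-- The bracket power `I^[p^e]`: the ideal generated by the image of `I` under the `e`-th iterate
of the Frobenius endomorphism. -/
def bracketPower {R : Type u} [CommRing R] (p : ℕ) [ExpChar R p] (I : Ideal R) (e : ℕ) : Ideal R :=
  I.map (iterateFrobenius R p e)

/-- The bracket Loewy length `drs_p(R)`: the infimum of the powers `p^e`, `e ≥ 0`, such that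
`𝔪^[p^e]` is contained in the ideal generated by some maximal `R`-sequence
(it is `⊤` if there is no such power). -/
noncomputable def bracketLoewyLength (R : Type u) [CommRing R] [IsLocalRing R]
    (p : ℕ) [ExpChar R p] : ℕ∞ :=
  sInf {q : ℕ∞ | ∃ e : ℕ, q = ((p ^ e : ℕ) : ℕ∞) ∧
    ∃ xs : List R, IsMaximalRegularSequence R xs ∧
      bracketPower p (IsLocalRing.maximalIdeal R) e ≤ Ideal.ofList xs}

/-- The `R`-module whose additive group is `R`, with scalar multiplication
`a • b = a ^ (p ^ n) * b`, that is, `R` viewed as a module over itself along the `n`-th iterate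
of the Frobenius endomorphism. -/
noncomputable def frobeniusModule (R : Type u) [CommRing R] (p : ℕ) [ExpChar R p] (n : ℕ) :
    ModuleCat.{u} R :=
  (ModuleCat.restrictScalars (iterateFrobenius R p n)).obj (ModuleCat.of R R)

/-- `Tor_i^R(M, N)`, computed by deriving the functor `- ⊗ N` and evaluating at `M`. -/
noncomputable abbrev torModule {R : Type u} [CommRing R] (i : ℕ) (M N : ModuleCat.{u} R) :
    ModuleCat.{u} R :=
  ((Tor' (ModuleCat.{u} R) i).obj M).obj N

end FrobeniusTor

/-! ### Exact complexes and regular sequences -/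

namespace FrobeniusTor

open RingTheory.Sequence
open scoped Pointwise

/-! Twist a minimal free resolution of `M` by Frobenius: the matrix entries lie in `𝔪`, so their `p
^ n`-th powers lie in `𝔪^[p^n]`, hence in `(xs)` for some maximal regular sequence `xs`. Vanishing
of Tor makes the twisted complex exact in `xs.length ≤ depth R` consecutive degrees.

Reducing modulo the terms of `xs` one at a time costs one exact degree each, and Nakayama then
forces the differential entering the top exact degree to vanish
(`differential_eq_zero_of_range_le`). Positive depth, which is all that the Cohen–Macaulay and
dimension hypotheses supply, makes `xs` nonempty, so by exactness the next twisted differential is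
injective.

Frobenius fixes every prime under preimage, and an associated-prime argument
(`mulVec_injective_of_map`) shows that the untwisted differential is injective too. The resolution
therefore stops. -/

theorem exact_quotSMulTop_map {R : Type*} [CommRing R] {A B C D : Type*}
    [AddCommGroup A] [AddCommGroup B] [AddCommGroup C] [AddCommGroup D]
    [Module R A] [Module R B] [Module R C] [Module R D]
    {f : A →ₗ[R] B} {g : B →ₗ[R] C} {h : C →ₗ[R] D} {x : R}
    (hfg : Function.Exact f g) (hgh : Function.Exact g h) (hx : IsSMulRegular D x) :
    Function.Exact (QuotSMulTop.map x f) (QuotSMulTop.map x g) := by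
  intro v
  obtain ⟨v, rfl⟩ := Submodule.mkQ_surjective _ v
  constructor
  · intro hv
    have hv' : g v ∈ x • (⊤ : Submodule R C) := by
      rw [← Submodule.Quotient.mk_eq_zero]; exact hv
    obtain ⟨u, -, hu⟩ := hv'
    replace hu : x • u = g v := hu
    -- Since `x • h u = h (g v) = 0`, regularity of `x` on `D` alone suffices; `u` then lifts to
    -- some `w`, and `x • w` corrects `v` to a cycle.
    have h0 : h u = 0 := by
      apply hx
      simp only [smul_zero]
      rw [← map_smul, hu, hgh.apply_apply_eq_zero]
    obtain ⟨w, rfl⟩ := (hgh u).1 h0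
    have h1 : g (v - x • w) = 0 := by simp [hu]
    obtain ⟨t, ht⟩ := (hfg _).1 h1
    refine ⟨Submodule.Quotient.mk t, ?_⟩
    change Submodule.Quotient.mk (f t) = Submodule.Quotient.mk v
    rw [ht, Submodule.Quotient.eq]
    have : v - x • w - v = x • (-w) := by simp
    rw [this]
    exact Submodule.smul_mem_pointwise_smul _ _ _ trivial
  · rintro ⟨t, ht⟩
    obtain ⟨t, rfl⟩ := Submodule.mkQ_surjective _ t
    rw [← ht]
    change Submodule.Quotient.mk (g (f t)) = _
    rw [hfg.apply_apply_eq_zero]; rfl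

/-- If a complex of finite modules over a local ring is exact in as many consecutive degrees as the
length of a regular sequence `xs`, then the differential entering the last of them can only be
divisible by `xs` if it is zero. -/
theorem differential_eq_zero_of_range_le {R : Type*} [CommRing R] [IsLocalRing R] (xs : List R)
    (hxs : ∀ x ∈ xs, x ∈ IsLocalRing.maximalIdeal R) (H : ℕ → Type*)
    [∀ i, AddCommGroup (H i)] [∀ i, Module R (H i)] [∀ i, Module.Finite R (H i)]
    (d : ∀ i, H (i + 1) →ₗ[R] H i) (hreg : ∀ i, IsWeaklyRegular (H i) xs)
    (hex : ∀ i < xs.length, Function.Exact (d (i + 1)) (d i))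
    (hd : LinearMap.range (d xs.length) ≤ Ideal.ofList xs • (⊤ : Submodule R (H xs.length))) :
    d xs.length = 0 := by
  induction xs generalizing H with
  | nil => simpa [LinearMap.range_eq_bot] using hd
  | cons x ys ih =>
    have hreg' := fun i => (isWeaklyRegular_cons_iff (H i) x ys).1 (hreg i)
    -- Exactness modulo `x` at one spot needs exactness at two spots upstairs, hence the shift of
    -- the complex by one.
    have h0 : QuotSMulTop.map x (d (ys.length + 1)) = 0 := by
      refine ih (fun y hy => hxs y (by simp [hy])) (fun i => QuotSMulTop x (H (i + 1)))
        (fun i => QuotSMulTop.map x (d (i + 1))) (fun i => (hreg' (i + 1)).2) ?_ ?_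
      · intro i hi
        exact exact_quotSMulTop_map (hex (i + 1) (by simpa using hi))
          (hex i (by simp; lia)) (hreg' i).1
      · rintro _ ⟨v, rfl⟩
        obtain ⟨v, rfl⟩ := Submodule.mkQ_surjective _ v
        have hv := hd ⟨v, rfl⟩
        rw [Ideal.ofList_cons, Submodule.sup_smul] at hv
        have hv' := Submodule.mem_map_of_mem
          (f := (x • (⊤ : Submodule R (H (ys.length + 1)))).mkQ) hv
        rw [Submodule.map_sup, Submodule.map_smul'', Submodule.map_smul'', Submodule.map_top,
          Submodule.range_mkQ] at hv'
        refine sup_le (c := Ideal.ofList ys • (⊤ : Submodule R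
          (QuotSMulTop x (H (ys.length + 1))))) ?_ le_rfl hv'
        rw [Submodule.smul_le]
        intro r hr n _
        have := QuotSMulTop.mem_annihilator (M := H (ys.length + 1)) x
        obtain ⟨c, rfl⟩ := Ideal.mem_span_singleton'.1 hr
        rw [mul_smul, Module.mem_annihilator.1 this n, smul_zero]
        exact zero_mem _
    -- A boundary `x • u` has `u` a cycle, as `x` is regular one degree lower; exactness makes `u` a
    -- boundary, and Nakayama applies.
    have key : LinearMap.range (d (ys.length + 1)) ≤
        Ideal.span {x} • LinearMap.range (d (ys.length + 1)) := by
      rintro _ ⟨v, rfl⟩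
      have hv : d (ys.length + 1) v ∈ x • (⊤ : Submodule R (H (ys.length + 1))) := by
        rw [← Submodule.Quotient.mk_eq_zero]
        exact LinearMap.congr_fun h0 (Submodule.Quotient.mk v)
      obtain ⟨u, -, hu⟩ := hv
      replace hu : x • u = d (ys.length + 1) v := hu
      have he := hex ys.length (by simp)
      have hu0 : d ys.length u = 0 := by
        apply (hreg' ys.length).1
        simp only [smul_zero]
        rw [← map_smul, hu, he.apply_apply_eq_zero]
      rw [← hu]
      exact Submodule.smul_mem_smul (Ideal.mem_span_singleton_self x) ((he u).1 hu0)
    have := Submodule.eq_bot_of_le_smul_of_le_jacobson_bot _ _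
      (Module.Finite.iff_fg.1 inferInstance) key (by
        rw [IsLocalRing.jacobson_eq_maximalIdeal _ bot_ne_top, Ideal.span_singleton_le_iff_mem]
        exact hxs x (by simp))
    simpa [LinearMap.range_eq_bot] using this

theorem isWeaklyRegular_of_flat {R : Type*} [CommRing R] (M : Type*) [AddCommGroup M] [Module R M]
    [Module.Flat R M] {xs : List R} (h : IsWeaklyRegular R xs) : IsWeaklyRegular M xs :=
  ((TensorProduct.lid R M).isWeaklyRegular_congr xs).1 h.isWeaklyRegular_rTensor

/-! ### Descent of injectivity along a ring endomorphism -/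

/-- An injective matrix over an integral domain has a left inverse up to a nonzero scalar. -/
theorem exists_mul_eq_smul_one {R : Type*} [CommRing R] [IsDomain R] {m ι : Type*} [Fintype m]
    [Fintype ι] [DecidableEq ι] (A : Matrix m ι R)
    (hA : Function.Injective A.mulVec) : ∃ (B : Matrix ι m R) (c : R), c ≠ 0 ∧ B * A = c • 1 := by
  classical
  let K := FractionRing R
  have hK : Function.Injective (A.map (algebraMap R K)).mulVecLin := by
    rw [← LinearMap.ker_eq_bot, LinearMap.ker_eq_bot']
    intro v hv
    obtain ⟨⟨c, hc⟩, hcv⟩ := IsLocalization.exist_integer_multiples (nonZeroDivisors R) Finset.univ v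
    choose w hw using fun i => hcv i (Finset.mem_univ i)
    have hw' : (algebraMap R K) ∘ w = c • v := by
      ext i; simpa using hw i
    have h1 : A.mulVec w = A.mulVec 0 := by
      ext i
      apply IsFractionRing.injective R K
      have h2 : (A.map (algebraMap R K)).mulVec ((algebraMap R K) ∘ w) = 0 := by
        rw [hw', Matrix.mulVec_smul]
        simpa using Or.inr hv
      rw [RingHom.map_mulVec, h2]
      simp
    have h3 := hA h1
    subst h3
    have hc0 : c ≠ 0 := nonZeroDivisors.ne_zero hc
    ext i
    have := congrFun hw' i
    simp only [Function.comp, Pi.zero_apply, map_zero, Pi.smul_apply] at this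
    rcases smul_eq_zero.1 this.symm with h | h
    · exact absurd h hc0
    · exact h
  obtain ⟨g, hg⟩ := LinearMap.exists_leftInverse_of_injective _ (LinearMap.ker_eq_bot.2 hK)
  let B := LinearMap.toMatrix' g
  have hB : B * A.map (algebraMap R K) = 1 := by
    have := congrArg LinearMap.toMatrix' hg
    rwa [LinearMap.toMatrix'_comp, LinearMap.toMatrix'_id, ← Matrix.toLin'_apply',
      LinearMap.toMatrix'_toLin'] at this
  obtain ⟨⟨c, hc⟩, hcB⟩ := IsLocalization.exist_integer_multiples (nonZeroDivisors R) Finset.univ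
    (fun ij : ι × m => B ij.1 ij.2)
  choose w hw using fun ij => hcB ij (Finset.mem_univ ij)
  refine ⟨Matrix.of fun i j => w (i, j), c, nonZeroDivisors.ne_zero hc, ?_⟩
  apply Matrix.map_injective (IsFractionRing.injective R K)
  beta_reduce
  have : (Matrix.of fun i j => w (i, j)).map (algebraMap R K) = c • B := by
    ext i j; simpa using hw (i, j)
  rw [Matrix.map_mul, this, Matrix.smul_mul, hB]
  ext i j
  by_cases hij : i = j <;> simp [hij, Algebra.smul_def (A := K)]

/-- Otherwise `ker A` has an associated prime `P = ann w`. If `A` is injective modulo `P`, a left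
inverse up to a scalar `c ∉ P` gives `c • w = 0`, a contradiction. If not, a kernel vector modulo
`P`, twisted by `φ` and multiplied by a coordinate of `w`, is a nonzero kernel vector of `A.map φ`.
-/
theorem mulVec_injective_of_map {R : Type*} [CommRing R] [IsNoetherianRing R] {m ι : Type*}
    [Fintype m] [Fintype ι] (φ : R →+* R)
    (hφ : ∀ P : Ideal R, P.IsPrime → P.comap φ = P) (A : Matrix m ι R)
    (hA : Function.Injective (A.map φ).mulVec) : Function.Injective A.mulVec := by
  classical
  by_contra hinj
  have hnt : Nontrivial (LinearMap.ker A.mulVecLin) := by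
    rw [Submodule.nontrivial_iff_ne_bot, Ne, LinearMap.ker_eq_bot]
    exact hinj
  obtain ⟨P, hP⟩ := associatedPrimes.nonempty R (LinearMap.ker A.mulVecLin)
  obtain ⟨hPp, ⟨w, hwA⟩, hw⟩ := (isAssociatedPrime_iff).1 hP
  replace hwA : A.mulVec w = 0 := hwA
  have hw' : ∀ r, r ∈ P ↔ r • w = 0 := by
    intro r
    rw [hw, Submodule.mem_colon_singleton]
    simp [Subtype.ext_iff]
  -- Some single coordinate has annihilator inside `P`: otherwise a product of elements outside `P`
  -- would kill `w`.
  obtain ⟨i, hi⟩ : ∃ i, ∀ r, r * w i = 0 → r ∈ P := by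
    by_contra! hcon
    choose r hr hrP using hcon
    have : ∏ i, r i ∈ P := by
      rw [hw']
      ext i
      rw [Pi.smul_apply, smul_eq_mul, ← Finset.prod_erase_mul _ _ (Finset.mem_univ i), mul_assoc,
        hr, mul_zero, Pi.zero_apply]
    obtain ⟨i, -, hi⟩ := (hPp.prod_mem_iff).1 this
    exact hrP i hi
  have hPw : ∀ r ∈ P, r * w i = 0 := fun r hr => congrFun ((hw' r).1 hr) i
  let π := Ideal.Quotient.mk P
  by_cases hAP : Function.Injective (A.map π).mulVec
  · obtain ⟨B, c, hc, hBA⟩ := exists_mul_eq_smul_one _ hAP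
    obtain ⟨c, rfl⟩ := Ideal.Quotient.mk_surjective c
    choose B' hB' using fun i j => Ideal.Quotient.mk_surjective (B i j)
    have hBB : B = (Matrix.of B').map π := by ext i j; exact (hB' i j).symm
    apply hc
    rw [Ideal.Quotient.eq_zero_iff_mem, hw']
    have hN : ∀ i j, (c • (1 : Matrix ι ι R) - Matrix.of B' * A) i j ∈ P := by
      intro i j
      rw [← Ideal.Quotient.eq_zero_iff_mem]
      have h1 := congrFun (congrFun hBA i) j
      rw [hBB, ← Matrix.map_mul, Matrix.map_apply] at h1
      rw [Matrix.sub_apply, map_sub, sub_eq_zero]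
      refine Eq.trans ?_ h1.symm
      by_cases hij : i = j <;> simp [hij]
    have h2 : (c • (1 : Matrix ι ι R) - Matrix.of B' * A).mulVec w = 0 := by
      ext k
      refine Finset.sum_eq_zero fun j _ => ?_
      exact congrFun ((hw' _).1 (hN k j)) j
    rw [Matrix.sub_mulVec, Matrix.smul_mulVec, Matrix.one_mulVec, ← Matrix.mulVec_mulVec, hwA,
      Matrix.mulVec_zero, sub_zero] at h2
    exact h2
  · have hker : ∃ v, (A.map π).mulVec v = 0 ∧ v ≠ 0 := by
      by_contra! hcon
      apply hAP
      change Function.Injective (A.map π).mulVecLin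
      rw [← LinearMap.ker_eq_bot, LinearMap.ker_eq_bot']
      exact hcon
    obtain ⟨v, hv, hv0⟩ := hker
    choose v' hv' using fun i => Ideal.Quotient.mk_surjective (v i)
    have hvv : v = π ∘ v' := by ext i; exact (hv' i).symm
    have h1 : ∀ k, φ (A.mulVec v' k) ∈ P := by
      intro k
      rw [← Ideal.mem_comap, hφ P hPp, ← Ideal.Quotient.eq_zero_iff_mem]
      have := congrFun hv k
      rw [hvv] at this
      rw [RingHom.map_mulVec]
      exact this
    have h2 : (A.map φ).mulVec (w i • (φ ∘ v')) = (A.map φ).mulVec 0 := by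
      ext k
      rw [Matrix.mulVec_smul, Matrix.mulVec_zero, Pi.smul_apply, ← RingHom.map_mulVec,
        smul_eq_mul, mul_comm]
      exact hPw _ (h1 k)
    have h3 := hA h2
    apply hv0
    ext k
    rw [← hv', Pi.zero_apply, Ideal.Quotient.eq_zero_iff_mem, ← hφ P hPp]
    apply hi
    rw [mul_comm]
    exact congrFun h3 k

theorem comap_iterateFrobenius {R : Type*} [CommRing R] (p : ℕ) [Fact p.Prime] [CharP R p] (n : ℕ)
    (P : Ideal R) (hP : P.IsPrime) : P.comap (iterateFrobenius R p n) = P := by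
  ext r
  rw [Ideal.mem_comap, iterateFrobenius_def]
  exact hP.pow_mem_iff_mem _ (pow_pos (Fact.out : p.Prime).pos n)

end FrobeniusTor

/-! ### Minimal free resolutions -/

namespace FrobeniusTor

open TensorProduct IsLocalRing

/-- Lift a basis of `k ⊗ N`: Nakayama gives generation, and linear independence over `k` puts the
coefficients of every relation in `𝔪`. -/
theorem exists_minimal_cover (R : Type*) [CommRing R] [IsLocalRing R] (N : Type*) [AddCommGroup N]
    [Module R N] [Module.Finite R N] :
    ∃ (b : ℕ) (f : (Fin b → R) →ₗ[R] N), Function.Surjective f ∧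
      ∀ v ∈ LinearMap.ker f, ∀ i, v i ∈ maximalIdeal R := by
  let k := ResidueField R
  let w := Module.finBasis k (k ⊗[R] N)
  choose v hv using fun i => TensorProduct.mk_surjective R N k Ideal.Quotient.mk_surjective (w i)
  refine ⟨_, Fintype.linearCombination R v, ?_, ?_⟩
  · rw [← LinearMap.range_eq_top, Fintype.range_linearCombination]
    exact span_eq_top_of_tmul_eq_basis v w hv
  · intro c hc i
    have h1 : ∑ j, (residue R (c j)) • w j = 0 := by
      have h2 := congrArg (TensorProduct.mk R k N 1) (LinearMap.mem_ker.1 hc)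
      rw [Fintype.linearCombination_apply, map_sum, map_zero] at h2
      rw [← h2]
      refine Finset.sum_congr rfl fun j _ => ?_
      rw [map_smul, hv, ← algebraMap_smul k (c j) (w j)]
      rfl
    exact (residue_eq_zero_iff _).1 (Fintype.linearIndependent_iff.1 w.linearIndependent _ h1 i)

section Resolution

variable (R : Type u) [CommRing R] [IsLocalRing R]

/-- The rank of a minimal free cover of a finite module. -/
noncomputable def coverRank (N : Type u) [AddCommGroup N] [Module R N] [Module.Finite R N] : ℕ :=
  (exists_minimal_cover R N).choose

/-- A minimal free cover of a finite module. -/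
noncomputable def cover (N : Type u) [AddCommGroup N] [Module R N] [Module.Finite R N] :
    (Fin (coverRank R N) → R) →ₗ[R] N :=
  (exists_minimal_cover R N).choose_spec.choose

theorem cover_surjective (N : Type u) [AddCommGroup N] [Module R N] [Module.Finite R N] :
    Function.Surjective (cover R N) :=
  (exists_minimal_cover R N).choose_spec.choose_spec.1

theorem mem_maximalIdeal_of_mem_ker_cover (N : Type u) [AddCommGroup N] [Module R N]
    [Module.Finite R N] {v : Fin (coverRank R N) → R} (hv : v ∈ LinearMap.ker (cover R N))
    (i : Fin (coverRank R N)) : v i ∈ maximalIdeal R :=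
  (exists_minimal_cover R N).choose_spec.choose_spec.2 v hv i

variable [IsNoetherianRing R] (M : Type u) [AddCommGroup M] [Module R M] [Module.Finite R M]

/-- The syzygies of a finite module in its minimal free resolution. -/
noncomputable def syzygy : ℕ → {N : ModuleCat.{u} R // Module.Finite R N}
  | 0 => ⟨ModuleCat.of R M, ‹_›⟩
  | k + 1 =>
    haveI := (syzygy k).2
    ⟨ModuleCat.of R (LinearMap.ker (cover R (syzygy k).1)),
      inferInstanceAs (Module.Finite R (LinearMap.ker (cover R (syzygy k).1)))⟩

instance (k : ℕ) : Module.Finite R (syzygy R M k).1 := (syzygy R M k).2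

/-- The Betti numbers of a finite module. -/
noncomputable def betti (k : ℕ) : ℕ := coverRank R (syzygy R M k).1

/-- The free cover of a syzygy. -/
noncomputable def syzygyCover (k : ℕ) : (Fin (betti R M k) → R) →ₗ[R] (syzygy R M k).1 :=
  cover R (syzygy R M k).1

/-- The inclusion of a syzygy in the preceding free module. -/
noncomputable def syzygyInclusion (k : ℕ) :
    (syzygy R M (k + 1)).1 →ₗ[R] (Fin (betti R M k) → R) :=
  (LinearMap.ker (cover R (syzygy R M k).1)).subtype

theorem syzygyCover_surjective (k : ℕ) : Function.Surjective (syzygyCover R M k) :=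
  cover_surjective R _

theorem syzygyInclusion_injective (k : ℕ) : Function.Injective (syzygyInclusion R M k) :=
  Subtype.val_injective

theorem exact_syzygyInclusion_syzygyCover (k : ℕ) :
    Function.Exact (syzygyInclusion R M k) (syzygyCover R M k) :=
  LinearMap.exact_subtype_ker_map _

/-- The differentials of the minimal free resolution. -/
noncomputable def minimalDifferential (k : ℕ) :
    (Fin (betti R M (k + 1)) → R) →ₗ[R] (Fin (betti R M k) → R) :=
  syzygyInclusion R M k ∘ₗ syzygyCover R M (k + 1)

theorem minimalDifferential_mem (k : ℕ) (v : Fin (betti R M (k + 1)) → R)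
    (i : Fin (betti R M k)) : minimalDifferential R M k v i ∈ maximalIdeal R :=
  mem_maximalIdeal_of_mem_ker_cover R (syzygy R M k).1 (Subtype.property (p := (· ∈ LinearMap.ker _))
    (syzygyCover R M (k + 1) v)) i

theorem exact_minimalDifferential_syzygyCover :
    Function.Exact (minimalDifferential R M 0) (syzygyCover R M 0) := by
  rw [LinearMap.exact_iff, minimalDifferential, LinearMap.range_comp_of_range_eq_top _
    (LinearMap.range_eq_top.2 (syzygyCover_surjective R M 1))]
  exact LinearMap.exact_iff.1 (exact_syzygyInclusion_syzygyCover R M 0)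

theorem exact_minimalDifferential (k : ℕ) :
    Function.Exact (minimalDifferential R M (k + 1)) (minimalDifferential R M k) := by
  rw [LinearMap.exact_iff, minimalDifferential, minimalDifferential,
    LinearMap.range_comp_of_range_eq_top _
      (LinearMap.range_eq_top.2 (syzygyCover_surjective R M (k + 2))),
    LinearMap.ker_comp_of_ker_eq_bot _ (LinearMap.ker_eq_bot.2 (syzygyInclusion_injective R M k))]
  exact LinearMap.exact_iff.1 (exact_syzygyInclusion_syzygyCover R M (k + 1))

/-- The complex underlying the minimal free resolution. -/
noncomputable def minimalComplex : ChainComplex (ModuleCat.{u} R) ℕ :=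
  ChainComplex.of (fun k => ModuleCat.of R (Fin (betti R M k) → R))
    (fun k => ModuleCat.ofHom (minimalDifferential R M k)) (fun k => by
      ext1
      exact (exact_minimalDifferential R M k).linearMap_comp_eq_zero)

theorem minimalComplex_d (k : ℕ) : (minimalComplex R M).d (k + 1) k =
    ModuleCat.ofHom (minimalDifferential R M k) :=
  by simp only [minimalComplex, ChainComplex.of_d]

/-- The augmentation of the minimal free resolution. -/
noncomputable def minimalAugmentation :
    minimalComplex R M ⟶ (ChainComplex.single₀ (ModuleCat.{u} R)).obj (ModuleCat.of R M) :=
  (ChainComplex.toSingle₀Equiv _ _).symm ⟨ModuleCat.ofHom (syzygyCover R M 0), by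
    rw [minimalComplex_d]
    ext1
    exact (exact_minimalDifferential_syzygyCover R M).linearMap_comp_eq_zero⟩

theorem minimalAugmentation_f_zero :
    (minimalAugmentation R M).f 0 = ModuleCat.ofHom (syzygyCover R M 0) :=
  ChainComplex.toSingle₀Equiv_symm_apply_f_zero _ _

/-- The minimal free resolution of a finite module. -/
noncomputable def minimalResolution : ProjectiveResolution (ModuleCat.of R M) where
  complex := minimalComplex R M
  projective k := (ModuleCat.of R (Fin (betti R M k) → R)).projective_of_free
    (Pi.basisFun R (Fin (betti R M k)))
  π := minimalAugmentation R M
  quasiIso := ⟨fun k => by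
    cases k with
    | zero =>
      rw [ChainComplex.quasiIsoAt₀_iff, ShortComplex.quasiIso_iff_of_zeros']
      · refine (ShortComplex.exact_and_epi_g_iff_of_iso (S₂ := ShortComplex.mk
          (ModuleCat.ofHom (minimalDifferential R M 0)) (ModuleCat.ofHom (syzygyCover R M 0))
          (by ext1; exact (exact_minimalDifferential_syzygyCover R M).linearMap_comp_eq_zero))
          ?_).2 ⟨?_, ?_⟩
        · exact ShortComplex.isoMk (Iso.refl _) (Iso.refl _) (Iso.refl _)
            ((Category.id_comp _).trans
              ((minimalComplex_d R M 0).symm.trans (Category.comp_id _).symm))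
            ((Category.id_comp _).trans
              ((minimalAugmentation_f_zero R M).symm.trans (Category.comp_id _).symm))
        · exact (ShortComplex.ShortExact.moduleCat_exact_iff_function_exact _).2
            (exact_minimalDifferential_syzygyCover R M)
        · exact (ModuleCat.epi_iff_surjective _).2 (syzygyCover_surjective R M 0)
      all_goals rfl
    | succ k =>
      rw [quasiIsoAt_iff_exactAt' _ _ (ChainComplex.exactAt_succ_single_obj _ _),
        HomologicalComplex.exactAt_iff' _ (k + 2) (k + 1) k (by simp) (by simp),
        ShortComplex.ShortExact.moduleCat_exact_iff_function_exact]
      change Function.Exact ((minimalComplex R M).d (k + 1 + 1) (k + 1)).hom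
        ((minimalComplex R M).d (k + 1) k).hom
      rw [minimalComplex_d, minimalComplex_d]
      exact exact_minimalDifferential R M k⟩

theorem exact_rTensor_minimalDifferential (N : ModuleCat.{u} R) (k : ℕ)
    (h : Limits.IsZero (torModule (k + 1) (ModuleCat.of R M) N)) :
    Function.Exact ((minimalDifferential R M (k + 1)).rTensor N)
      ((minimalDifferential R M k).rTensor N) := by
  have h1 := h.of_iso ((minimalResolution R M).isoLeftDerivedObj
    ((MonoidalCategory.tensoringRight (ModuleCat.{u} R)).obj N) (k + 1)).symm
  have h2 := (HomologicalComplex.exactAt_iff_isZero_homology _ _).2 h1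
  rw [HomologicalComplex.exactAt_iff' _ (k + 2) (k + 1) k (by simp) (by simp),
    ShortComplex.ShortExact.moduleCat_exact_iff_function_exact] at h2
  have h3 : Function.Exact (((minimalComplex R M).d (k + 1 + 1) (k + 1)).hom.rTensor N)
    (((minimalComplex R M).d (k + 1) k).hom.rTensor N) := h2
  rw [minimalComplex_d, minimalComplex_d] at h3
  exact h3

theorem hasProjectiveDimensionLT_syzygy {m k : ℕ} (j : ℕ)
    (h : HasProjectiveDimensionLT (syzygy R M (j + k)).1 m) :
    HasProjectiveDimensionLT (syzygy R M k).1 (m + j) := by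
  induction j generalizing k with
  | zero => simpa using h
  | succ j ih =>
    have h1 := ih (k := k + 1) (by rwa [show j + (k + 1) = j + 1 + k by lia])
    have h2 := LinearMap.shortExact_shortComplexKer (syzygyCover_surjective R M k)
    have : Projective (ModuleCat.of R (Fin (betti R M k) → R)) :=
      ModuleCat.projective_of_free (Pi.basisFun R (Fin (betti R M k)))
    exact h2.hasProjectiveDimensionLT_X₃ (m + j) h1
      (hasProjectiveDimensionLT_of_ge (ModuleCat.of R (Fin (betti R M k) → R)) 1 _ (by lia))

/-- Injectivity makes the cover of syzygy `k + 1` injective, so syzygy `k + 2` is zero. -/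
theorem projectiveDimension_lt_top_of_injective (k : ℕ)
    (h : Function.Injective (minimalDifferential R M k)) :
    projectiveDimension (ModuleCat.of R M) < ⊤ := by
  have h1 : Function.Injective (syzygyCover R M (k + 1)) := 
    Function.Injective.of_comp (f := syzygyInclusion R M k) h
  have h2 : Subsingleton (syzygy R M (k + 2)).1 := by
    refine ⟨fun a b => ?_⟩
    apply syzygyInclusion_injective R M (k + 1)
    apply h1
    rw [(exact_syzygyInclusion_syzygyCover R M (k + 1)).apply_apply_eq_zero,
      (exact_syzygyInclusion_syzygyCover R M (k + 1)).apply_apply_eq_zero]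
  have h3 := hasProjectiveDimensionLT_syzygy R M (m := 0) (k := 0) (k + 2)
    (ModuleCat.isZero_of_subsingleton (syzygy R M (k + 2)).1).hasProjectiveDimensionLT_zero
  rw [lt_top_iff_ne_top, projectiveDimension_ne_top_iff]
  exact ⟨0 + (k + 2), hasProjectiveDimensionLT_of_ge (syzygy R M 0).1 (0 + (k + 2)) _ (by lia)⟩

end Resolution

/-! ### Base change of free modules along a twist -/

section Twist

variable {R : Type*} [CommRing R] (φ : R →+* R) {N : Type*} [AddCommGroup N] [Module R N]
  (ψ : N ≃+ R)

/-- If `N` is `R` with scalars twisted by `φ`, then `Rᵃ ⊗ N` is `Rᵃ` with scalars so twisted. -/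
noncomputable def piTensorTwistEquiv (a : ℕ) : (Fin a → R) ⊗[R] N ≃+ (Fin a → R) :=
  ((TensorProduct.comm R (Fin a → R) N).trans
    (TensorProduct.piScalarRight R R N (Fin a))).toAddEquiv.trans (AddEquiv.piCongrRight fun _ => ψ)

theorem piTensorTwistEquiv_tmul (hψ : ∀ r x, ψ (r • x) = φ r * ψ x) (a : ℕ) (v : Fin a → R)
    (x : N) (i : Fin a) : piTensorTwistEquiv ψ a (v ⊗ₜ x) i = φ (v i) * ψ x := by
  rw [← hψ]
  simp [piTensorTwistEquiv, TensorProduct.piScalarRightHom_tmul]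

theorem piTensorTwistEquiv_rTensor (hψ : ∀ r x, ψ (r • x) = φ r * ψ x) {a b : ℕ}
    (f : (Fin a → R) →ₗ[R] (Fin b → R)) (t : (Fin a → R) ⊗[R] N) :
    piTensorTwistEquiv ψ b (f.rTensor N t) =
      ((LinearMap.toMatrix' f).map φ).mulVec (piTensorTwistEquiv ψ a t) := by
  induction t using TensorProduct.induction_on with
  | zero => simp
  | add s t hs ht => rw [map_add, map_add, hs, ht, map_add, Matrix.mulVec_add]
  | tmul v x =>
    ext i
    rw [LinearMap.rTensor_tmul, piTensorTwistEquiv_tmul φ ψ hψ, ← LinearMap.toMatrix'_mulVec f v]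
    simp [Matrix.mulVec, dotProduct, piTensorTwistEquiv_tmul φ ψ hψ, Finset.sum_mul, mul_assoc]

theorem exact_mulVec_of_exact_rTensor (hψ : ∀ r x, ψ (r • x) = φ r * ψ x) {a b c : ℕ}
    {f : (Fin a → R) →ₗ[R] (Fin b → R)} {g : (Fin b → R) →ₗ[R] (Fin c → R)}
    (h : Function.Exact (f.rTensor N) (g.rTensor N)) :
    Function.Exact ((LinearMap.toMatrix' f).map φ).mulVec
      ((LinearMap.toMatrix' g).map φ).mulVec := by
  intro y
  obtain ⟨y, rfl⟩ := (piTensorTwistEquiv ψ b).surjective y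
  rw [← piTensorTwistEquiv_rTensor φ ψ hψ, EmbeddingLike.map_eq_zero_iff, h y]
  constructor
  · rintro ⟨t, rfl⟩
    exact ⟨_, (piTensorTwistEquiv_rTensor φ ψ hψ f t).symm⟩
  · rintro ⟨t, ht⟩
    obtain ⟨t, rfl⟩ := (piTensorTwistEquiv ψ a).surjective t
    rw [← piTensorTwistEquiv_rTensor φ ψ hψ] at ht
    exact ⟨t, (piTensorTwistEquiv ψ b).injective ht⟩

end Twist

end FrobeniusTor

/-! ### Maximal regular sequences and the bracket Loewy length -/

namespace FrobeniusTor

open RingTheory.Sequence IsLocalRing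

theorem mem_maximalIdeal_of_isRegular {R : Type*} [CommRing R] [IsLocalRing R] {xs : List R}
    (h : IsRegular R xs) : ∀ x ∈ xs, x ∈ maximalIdeal R := by
  intro x hx
  have h1 : Ideal.ofList xs ≠ ⊤ := by
    intro h2
    apply h.top_ne_smul
    rw [h2, Submodule.top_smul]
  exact le_maximalIdeal h1 (Ideal.subset_span hx)

theorem length_pos_of_isMaximalRegularSequence {R : Type u} [CommRing R] [IsLocalRing R]
    (hdepth : 0 < depth R) {xs : List R} (h : IsMaximalRegularSequence R xs) : 0 < xs.length := by
  by_contra! h0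
  obtain rfl : xs = [] := List.eq_nil_of_length_eq_zero (by lia)
  obtain ⟨_, ⟨ys, hys, rfl⟩, hpos⟩ := lt_sSup_iff.1 hdepth
  cases ys with
  | nil => simp at hpos
  | cons y ys =>
    apply h.2 y
    rw [List.nil_append]
    refine (isRegular_iff_isWeaklyRegular_of_subset_maximalIdeal ?_).2
      ((isWeaklyRegular_singleton_iff R y).2 ((isRegular_cons_iff R y ys).1 hys).1)
    intro r hr
    exact mem_maximalIdeal_of_isRegular hys r (by simp_all)

theorem exists_bracketPower_le_of_bracketLoewyLength_le {R : Type u} [CommRing R] [IsLocalRing R]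
    {p : ℕ} [Fact p.Prime] [CharP R p] {n : ℕ}
    (hn : bracketLoewyLength R p ≤ ((p ^ n : ℕ) : ℕ∞)) :
    ∃ xs : List R, IsMaximalRegularSequence R xs ∧
      bracketPower p (maximalIdeal R) n ≤ Ideal.ofList xs := by
  -- The strict bound turns the infimum into an actual power `p ^ e ≤ p ^ n`; bracket powers
  -- decrease, so `e` may be replaced by `n`.
  have hlt : bracketLoewyLength R p < ((p ^ n : ℕ) : ℕ∞) + 1 :=
    lt_of_le_of_lt hn (by exact_mod_cast Nat.lt_succ_self _)
  obtain ⟨_, ⟨e, rfl, xs, hxs, hle⟩, hq⟩ := sInf_lt_iff.1 hlt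
  have hen : e ≤ n := by
    have : p ^ e < p ^ n + 1 := by exact_mod_cast hq
    exact (Nat.pow_le_pow_iff_right (Fact.out : p.Prime).one_lt).1 (by lia)
  refine ⟨xs, hxs, le_trans ?_ hle⟩
  rw [bracketPower, Ideal.map_le_iff_le_comap]
  intro r hr
  obtain ⟨m, rfl⟩ := Nat.exists_eq_add_of_le hen
  rw [Ideal.mem_comap, iterateFrobenius_add_apply]
  exact Ideal.mem_map_of_mem _ ((comap_iterateFrobenius p m _ inferInstance).ge hr)

end FrobeniusTor

theorem theorem2p2p10 (R : Type u) [CommRing R] [IsLocalRing R] [IsNoetherianRing R]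
    (p : ℕ) [Fact p.Prime] [CharP R p]
    (hCM : FrobeniusTor.IsCohenMacaulayLocal R) (hdim : 0 < ringKrullDim R)
    (n : ℕ) (hn : FrobeniusTor.bracketLoewyLength R p ≤ ((p ^ n : ℕ) : ℕ∞))
    (M : Type u) [AddCommGroup M] [Module R M] [Module.Finite R M]
    (s : ℕ) (hs : 0 < s)
    (hTor : ∀ i : ℕ, s ≤ i → (i : ℕ∞) < (s : ℕ∞) + FrobeniusTor.depth R →
      Limits.IsZero (FrobeniusTor.torModule i (ModuleCat.of R M)
        (FrobeniusTor.frobeniusModule R p n))) :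
    projectiveDimension (ModuleCat.of R M) < ⊤ := by
  obtain ⟨xs, hxs, hle⟩ := FrobeniusTor.exists_bracketPower_le_of_bracketLoewyLength_le hn
  have hdepth : 0 < FrobeniusTor.depth R := by
    rw [← hCM] at hdim
    exact_mod_cast hdim
  have hlen : (xs.length : ℕ∞) ≤ FrobeniusTor.depth R := le_sSup ⟨xs, hxs.1, rfl⟩
  have hpos := FrobeniusTor.length_pos_of_isMaximalRegularSequence hdepth hxs
  obtain ⟨t, rfl⟩ : ∃ t, s = t + 1 := ⟨s - 1, by lia⟩
  let φ := iterateFrobenius R p n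
  let A := fun k => LinearMap.toMatrix' (FrobeniusTor.minimalDifferential R M k)
  have hexact : ∀ j < xs.length, Function.Exact ((A (t + (j + 1))).map φ).mulVec
      ((A (t + j)).map φ).mulVec := by
    intro j hj
    refine FrobeniusTor.exact_mulVec_of_exact_rTensor φ
      (N := FrobeniusTor.frobeniusModule R p n) (AddEquiv.refl R) (fun _ _ => rfl)
      (FrobeniusTor.exact_rTensor_minimalDifferential R M _ (t + j) (hTor _ (by lia) ?_))
    refine lt_of_lt_of_le ?_ (add_le_add_right hlen _)
    exact_mod_cast (by lia : t + j + 1 < t + 1 + xs.length)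
  have hzero : ((A (t + xs.length)).map φ).mulVecLin = 0 := by
    refine FrobeniusTor.differential_eq_zero_of_range_le xs
      (FrobeniusTor.mem_maximalIdeal_of_isRegular hxs.1)
      (fun i => Fin (FrobeniusTor.betti R M (t + i)) → R) (fun i => ((A (t + i)).map φ).mulVecLin)
      (fun i => FrobeniusTor.isWeaklyRegular_of_flat _ hxs.1.toIsWeaklyRegular) hexact ?_
    rintro _ ⟨v, rfl⟩
    rw [pi_eq_sum_univ' (((A (t + xs.length)).map φ).mulVecLin v)]
    refine sum_mem fun i _ => Submodule.smul_mem_smul ?_ trivial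
    change ∑ j, φ (A (t + xs.length) i j) * v j ∈ Ideal.ofList xs
    refine sum_mem fun j _ => Ideal.mul_mem_right _ _ (hle (Ideal.mem_map_of_mem _ ?_))
    rw [show A (t + xs.length) i j = _ from LinearMap.toMatrix'_apply _ i j]
    exact FrobeniusTor.minimalDifferential_mem R M _ _ i
  -- Exactness at the last index `l` identifies the kernel of the twisted `A (t + l)` with the image
  -- of the zero map.
  obtain ⟨l, hl⟩ : ∃ l, xs.length = l + 1 := ⟨xs.length - 1, by lia⟩
  have hinj : Function.Injective ((A (t + l)).map φ).mulVec := by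
    change Function.Injective ((A (t + l)).map φ).mulVecLin
    rw [← LinearMap.ker_eq_bot, LinearMap.ker_eq_bot']
    intro v hv
    obtain ⟨w, rfl⟩ := (hexact l (by lia) v).1 hv
    rw [hl] at hzero
    exact LinearMap.congr_fun hzero w
  have hA := FrobeniusTor.mulVec_injective_of_map φ (FrobeniusTor.comap_iterateFrobenius p n) _ hinj
  refine FrobeniusTor.projectiveDimension_lt_top_of_injective R M (t + l) ?_
  intro v w hvw
  apply hA
  rw [LinearMap.toMatrix'_mulVec, LinearMap.toMatrix'_mulVec, hvw]
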